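/- Let $\mathcal H$ be a separable real Hilbert space with a complete orthonormal system $\{e_i\}$ (indexed by $\mathbb N$, or by a finite set if $\dim\mathcal H<\infty$). Let $A$ be the infinitesimal generator of a strongly continuous semigroup $\exp(tA)$ on $\mathcal H$ that is exponentially stable: $\|\exp(tA)\|\le Me^{-\omega t}$ for all $t\ge 0$, with constants $M,\omega>0$. For weights $p=\{p_i\}$ with $p_i\ge 0$ and $\sum_i p_i<\infty$, let $B=B(p)$ be the bounded operator with $Be_i=\sqrt{p_i}\,e_i$, and let $$W(p)=\int_0^\infty \exp(tA)BB^*\exp(tA)^*\,dt ,\qquad W_i=\int_0^\infty \exp(tA)P_iP_i^*\exp(tA)^*\,dt,$$ where $P_iz=\langle z,e_i\rangle e_i$. For $k\ge 1$ let $\mu_k(W(p))$ be the $k$-th eigenvalue of the compact positive semidefinite operator $W(p)$, in descending order and counted with multiplicity (in the finite-dimensional case only $k\le\dim\mathcal H$ has a meaning; set $\mu_k=0$ for larger $k$). Fix an integer $n\ge 1$ and a finite set $I$ of indices (the input nodes), and set $$\Delta=\Big\{p \;\Big|\; p_i\ge 0 \text{ for all } i,\ p_i=0 \text{ for } i\notin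 I,\ \sum_{i\in I}p_i=1\Big\},\qquad X=\{p \mid \mu_n(W(p))>0\}.$$ The VCS problem is to minimize $f(p)=-\log\prod_{k=1}^n\mu_k(W(p))$ over $p\in\Delta\cap X$; the AECS problem is to minimize $g(p)=\sum_{k=1}^n \frac{1}{\mu_k(W(p))}$ over $p\in\Delta\cap X$. Assume that 1. $\Delta\cap X\neq\emptyset$; 2. $W_iW_j=W_jW_i$ for all indices $i,j$; 3. there are orthonormal vectors $z_1,\dots,z_n\in\mathcal H$, each of which is an eigenvector of every $W_i$, such that for every $i\in I$ the restriction of $W_i$ to $(\operatorname{span}\{z_1,\dots,z_n\})^\perp$ is $0$. Then the VCS problem has exactly one optimal solution, and the AECS problem has exactly one optimal solution. -/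

import Mathlib

open MeasureTheory Set Filter Topology
open scoped InnerProductSpace

noncomputable section

namespace ControllabilityScore

variable {H : Type*} [NormedAddCommGroup H] [InnerProductSpace ℝ H]

/-- A strongly continuous one-parameter semigroup of bounded operators on `H`. Only the values at
times `t ≥ 0` matter. -/
structure C0Semigroup (H : Type*) [NormedAddCommGroup H] [InnerProductSpace ℝ H] where
  toFun : ℝ → H →L[ℝ] H
  map_zero : toFun 0 = ContinuousLinearMap.id ℝ H
  map_add : ∀ s t : ℝ, 0 ≤ s → 0 ≤ t → toFun (s + t) = (toFun s).comp (toFun t)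
  continuousOn_orbit : ∀ x : H, ContinuousOn (fun t => toFun t x) (Ici 0)

/-- `A` is the infinitesimal generator of `S`, that is, `S t = exp (t A)`: the domain of `A`
consists of the `x` for which `(S t x - x) / t` converges as `t → 0+`, and `A x` is the limit. -/
def IsGenerator (A : H →ₗ.[ℝ] H) (S : C0Semigroup H) : Prop :=
  ∀ x y : H, (x, y) ∈ A.graph ↔
    Tendsto (fun t : ℝ => t⁻¹ • (S.toFun t x - x)) (𝓝[>] 0) (𝓝 y)

/-- Exponential stability: `‖S t‖ ≤ M exp (-ω t)` for all `t ≥ 0`, with `M, ω > 0`. -/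
def ExponentiallyStable (S : C0Semigroup H) : Prop :=
  ∃ M ω : ℝ, 0 < M ∧ 0 < ω ∧ ∀ t : ℝ, 0 ≤ t → ‖S.toFun t‖ ≤ M * Real.exp (-ω * t)

variable [CompleteSpace H]

/-- The infinite-horizon controllability Gramian `∫₀^∞ S(t) B B* S(t)* dt` of the input
operator `B`. -/
def gramian (S : C0Semigroup H) (B : H →L[ℝ] H) : H →L[ℝ] H :=
  ∫ t in Ioi (0 : ℝ), (S.toFun t).comp
    (B.comp ((ContinuousLinearMap.adjoint B).comp (ContinuousLinearMap.adjoint (S.toFun t))))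

variable {ι : Type*}

/-- The projection `P_i z = ⟪z, e i⟫ e i` onto the line spanned by `e i`. -/
def nodeProjection (e : HilbertBasis ι ℝ H) (i : ι) : H →L[ℝ] H :=
  InnerProductSpace.rankOne ℝ (e i) (e i)

/-- The input operator `B` with weights `p`, that is, the bounded operator with
`B (e i) = √(p i) • e i`. -/
def inputOperator (e : HilbertBasis ι ℝ H) (p : ι → ℝ) : H →L[ℝ] H :=
  ∑' i, √(p i) • nodeProjection e i

/-- For nonnegative summable weights the series defining the input operator converges in
operator norm. -/
theorem summable_inputOperator (e : HilbertBasis ι ℝ H) (p : ι → ℝ) (hp : ∀ i, 0 ≤ p i)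
    (hs : Summable p) : Summable fun i => √(p i) • nodeProjection e i := by
  have key : ∀ t : Finset ι,
      ‖∑ i ∈ t, √(p i) • nodeProjection e i‖ ≤ √(∑ i ∈ t, p i) := by
    intro t
    refine ContinuousLinearMap.opNorm_le_bound _ (Real.sqrt_nonneg _) fun x => ?_
    have h1 : (∑ i ∈ t, √(p i) • nodeProjection e i) x
        = ∑ i ∈ t, (√(p i) * ⟪e i, x⟫_ℝ) • e i := by
      simp [nodeProjection, smul_smul]
    have h2 : ‖∑ i ∈ t, (√(p i) * ⟪e i, x⟫_ℝ) • e i‖ ^ 2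
        = ∑ i ∈ t, p i * ⟪e i, x⟫_ℝ ^ 2 := by
      rw [← real_inner_self_eq_norm_sq, e.orthonormal.inner_sum]
      refine Finset.sum_congr rfl fun i _ => ?_
      have := Real.mul_self_sqrt (hp i)
      simp only [conj_trivial]
      linear_combination (⟪e i, x⟫_ℝ ^ 2) * this
    rw [h1]
    refine (sq_le_sq₀ (norm_nonneg _) (by positivity)).1 ?_
    rw [h2, mul_pow, Real.sq_sqrt (Finset.sum_nonneg fun i _ => hp i), Finset.sum_mul]
    refine Finset.sum_le_sum fun i _ => mul_le_mul_of_nonneg_left ?_ (hp i)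
    have h3 : |⟪e i, x⟫_ℝ| ≤ ‖x‖ := by
      simpa [e.orthonormal.norm_eq_one i] using abs_real_inner_le_norm (e i) x
    exact sq_le_sq' (by linarith [neg_abs_le ⟪e i, x⟫_ℝ]) ((le_abs_self _).trans h3)
  rw [summable_iff_vanishing_norm]
  intro ε hε
  obtain ⟨s, h⟩ := (summable_iff_vanishing_norm.1 hs) (ε ^ 2) (by positivity)
  refine ⟨s, fun t ht => (key t).trans_lt ?_⟩
  rw [Real.sqrt_lt' hε]
  exact (le_abs_self _).trans_lt (h t ht)

/-- The defining property of the input operator. -/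
theorem inputOperator_apply (e : HilbertBasis ι ℝ H) (p : ι → ℝ) (hp : ∀ i, 0 ≤ p i)
    (hs : Summable p) (i : ι) : inputOperator e p (e i) = √(p i) • e i := by
  classical
  have h := (summable_inputOperator e p hp hs).hasSum.mapL
    (ContinuousLinearMap.apply ℝ H (e i))
  refine h.unique ?_
  have h' := hasSum_ite_eq i (√(p i) • e i)
  convert h' using 2 with j
  by_cases hj : j = i
  · subst hj; simp [nodeProjection, e.orthonormal.norm_eq_one]
  · simp [nodeProjection, e.orthonormal.inner_eq_zero hj, hj]

/-- The controllability Gramian `W(p)` of the system with weights `p`. -/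
def weightedGramian (S : C0Semigroup H) (e : HilbertBasis ι ℝ H) (p : ι → ℝ) : H →L[ℝ] H :=
  gramian S (inputOperator e p)

/-- The single-node Gramian `W_i = ∫₀^∞ S(t) P_i P_i* S(t)* dt`. -/
def nodeGramian (S : C0Semigroup H) (e : HilbertBasis ι ℝ H) (i : ι) : H →L[ℝ] H :=
  gramian S (nodeProjection e i)

/-- `eigenvalueDesc T k`, for `k ≥ 1` and `T` compact, self-adjoint and positive, is the `k`-th
eigenvalue of `T` in descending order, counted with multiplicity: the largest `c` such that `T`
has `k` orthonormal eigenvectors whose eigenvalues are at least `c`. -/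
def eigenvalueDesc (T : H →L[ℝ] H) (k : ℕ) : ℝ :=
  sSup {c : ℝ | ∃ v : Fin k → H, Orthonormal ℝ v ∧
    ∀ j, ∃ l : ℝ, c ≤ l ∧ T (v j) = l • v j}

/-- The set `Δ` of weights: nonnegative, supported on the finite set `I` of input nodes, with
total mass one. -/
def weightSimplex (I : Finset ι) : Set (ι → ℝ) :=
  {p | (∀ i, 0 ≤ p i) ∧ (∀ i, i ∉ I → p i = 0) ∧ ∑ i ∈ I, p i = 1}

/-- The set `X` of weights for which the `n`-th eigenvalue of `W(p)` is positive. -/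
def controllableWeights (S : C0Semigroup H) (e : HilbertBasis ι ℝ H) (n : ℕ) : Set (ι → ℝ) :=
  {p | 0 < eigenvalueDesc (weightedGramian S e p) n}

/-- The feasible set `Δ ∩ X` of both optimization problems. -/
def feasibleSet (S : C0Semigroup H) (e : HilbertBasis ι ℝ H) (I : Finset ι) (n : ℕ) :
    Set (ι → ℝ) :=
  weightSimplex I ∩ controllableWeights S e n

/-- The objective `f(p) = -log ∏_{k=1}^n μ_k(W(p))` of the volumetric controllability score. -/
def vcsObjective (S : C0Semigroup H) (e : HilbertBasis ι ℝ H) (n : ℕ) (p : ι → ℝ) : ℝ :=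
  -Real.log (∏ k ∈ Finset.Icc 1 n, eigenvalueDesc (weightedGramian S e p) k)

/-- The objective `g(p) = ∑_{k=1}^n 1 / μ_k(W(p))` of the average energy controllability
score. -/
def aecsObjective (S : C0Semigroup H) (e : HilbertBasis ι ℝ H) (n : ℕ) (p : ι → ℝ) : ℝ :=
  ∑ k ∈ Finset.Icc 1 n, 1 / eigenvalueDesc (weightedGramian S e p) k

/-- `p` is an optimal solution of: minimize `h` over the set `F`. -/
def IsOptimalSolution (h : (ι → ℝ) → ℝ) (F : Set (ι → ℝ)) (p : ι → ℝ) : Prop :=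
  p ∈ F ∧ ∀ q ∈ F, h p ≤ h q

end ControllabilityScore

end

/-! On `Δ` the Gramian is linear in the weights, `W(p) = ∑ p_i W_i`. All `W_i` are diagonal on the
`z_k`, and `W(p)` vanishes on their orthogonal complement. So `μ_1, …, μ_n` are, up to order, the
linear forms `L_k(p) = ∑ p_i a_{ik}` (`exists_perm_eigenvalueDesc_eq`). Both objectives are
symmetric in the eigenvalues, hence equal `∑ φ(L_k(p))` with `φ = -log` or `φ = 1/x`, and
feasibility means that all `L_k(p)` are positive.

Uniqueness: `φ` is strictly convex, so the sum is strictly convex once `L` is injective on `Δ`.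
Since `L(p)` determines `W(p)`, this reduces to linear independence of the `W_i`
(`linearIndependent_nodeGramian`). Existence: `Δ` is compact and both objectives blow up where some
`L_k` tends to `0`. -/

namespace ControllabilityScore

open InnerProductSpace

/-! ### Gramians: integral formulas, linear independence, linearity in the weights -/

section Gramian

variable {H : Type*} [NormedAddCommGroup H] [InnerProductSpace ℝ H]

/-- The integrand of a single-node Gramian is continuous in the operator norm. -/
theorem continuousOn_rankOne_orbit (S : C0Semigroup H) (x : H) :
    ContinuousOn (fun t => rankOne ℝ (S.toFun t x) (S.toFun t x)) (Ici 0) := by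
  have h := S.continuousOn_orbit x
  have h1 : ContinuousOn (fun t => rankOne ℝ (S.toFun t x)) (Ici 0) :=
    (rankOne ℝ (E := H) (F := H)).continuous.comp_continuousOn h
  exact h1.clm_apply h

/-- The integrand of a single-node Gramian is integrable for an exponentially stable semigroup. -/
theorem integrableOn_rankOne_orbit {S : C0Semigroup H} (hS : ExponentiallyStable S) (x : H) :
    IntegrableOn (fun t => rankOne ℝ (S.toFun t x) (S.toFun t x)) (Ioi 0) := by
  obtain ⟨M, ω, hM, hω, hb⟩ := hS
  have hdom : IntegrableOn (fun t => (M * ‖x‖) ^ 2 * Real.exp (-(2 * ω) * t)) (Ioi 0) :=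
    (exp_neg_integrableOn_Ioi 0 (by positivity : 0 < 2 * ω)).const_mul _
  refine Integrable.mono' hdom
    (((continuousOn_rankOne_orbit S x).mono Ioi_subset_Ici_self).aestronglyMeasurable
      measurableSet_Ioi) ?_
  refine (ae_restrict_iff' measurableSet_Ioi).2 (Eventually.of_forall fun t ht => ?_)
  have h1 : ‖S.toFun t x‖ ≤ M * Real.exp (-ω * t) * ‖x‖ :=
    (S.toFun t).le_of_opNorm_le (hb t (le_of_lt ht)) x
  have h2 : Real.exp (-(2 * ω) * t) = Real.exp (-ω * t) * Real.exp (-ω * t) := by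
    rw [← Real.exp_add]; ring_nf
  rw [norm_rankOne, h2]
  calc ‖S.toFun t x‖ * ‖S.toFun t x‖
      ≤ (M * Real.exp (-ω * t) * ‖x‖) * (M * Real.exp (-ω * t) * ‖x‖) := by gcongr
    _ = _ := by ring

theorem integrableOn_sq_inner_orbit {S : C0Semigroup H} (hS : ExponentiallyStable S) (x y : H) :
    IntegrableOn (fun t => ⟪S.toFun t x, y⟫_ℝ ^ 2) (Ioi 0) := by
  have h := ((innerSL ℝ y).comp (ContinuousLinearMap.apply ℝ H y)).integrable_comp
    (integrableOn_rankOne_orbit hS x)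
  refine Integrable.congr h (Eventually.of_forall fun t => ?_)
  simp [real_inner_comm y, sq]

variable [CompleteSpace H] {ι : Type*}

theorem nodeGramian_eq_integral (S : C0Semigroup H) (e : HilbertBasis ι ℝ H) (i : ι) :
    nodeGramian S e i = ∫ t in Ioi (0 : ℝ), rankOne ℝ (S.toFun t (e i)) (S.toFun t (e i)) := by
  unfold nodeGramian gramian
  congr 1
  funext t
  ext x
  simp [nodeProjection, ContinuousLinearMap.adjoint_inner_right, e.orthonormal.norm_eq_one]

/-- The quadratic form of a single-node Gramian. -/
theorem inner_nodeGramian {S : C0Semigroup H} (hS : ExponentiallyStable S)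
    (e : HilbertBasis ι ℝ H) (i : ι) (y : H) :
    ⟪y, nodeGramian S e i y⟫_ℝ = ∫ t in Ioi (0 : ℝ), ⟪S.toFun t (e i), y⟫_ℝ ^ 2 := by
  rw [nodeGramian_eq_integral]
  have h := ((innerSL ℝ y).comp (ContinuousLinearMap.apply ℝ H y)).integral_comp_comm
    (integrableOn_rankOne_orbit hS (e i))
  refine Eq.trans h.symm (integral_congr_ae (Eventually.of_forall fun t => ?_))
  simp [real_inner_comm y, sq]

theorem inner_nodeGramian_nonneg {S : C0Semigroup H} (hS : ExponentiallyStable S)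
    (e : HilbertBasis ι ℝ H) (i : ι) (y : H) : 0 ≤ ⟪y, nodeGramian S e i y⟫_ℝ := by
  rw [inner_nodeGramian hS]
  exact integral_nonneg fun t => sq_nonneg _

/-- Testing a single-node Gramian against `S(t)* y` cuts off the part of the integral before
time `t`. -/
theorem inner_nodeGramian_adjoint {S : C0Semigroup H} (hS : ExponentiallyStable S)
    (e : HilbertBasis ι ℝ H) (i : ι) (y : H) {t : ℝ} (ht : 0 ≤ t) :
    ⟪ContinuousLinearMap.adjoint (S.toFun t) y,
        nodeGramian S e i (ContinuousLinearMap.adjoint (S.toFun t) y)⟫_ℝ =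
      ∫ s in Ioi t, ⟪S.toFun s (e i), y⟫_ℝ ^ 2 := by
  rw [inner_nodeGramian hS]
  have h := (measurePreserving_add_left (volume : Measure ℝ) t).setIntegral_preimage_emb
    (measurableEmbedding_addLeft t) (fun s => ⟪S.toFun s (e i), y⟫_ℝ ^ 2) (Ioi t)
  rw [← h]
  simp only [preimage_const_add_Ioi, sub_self]
  refine setIntegral_congr_fun measurableSet_Ioi fun s hs => ?_
  simp only [S.map_add t s ht (le_of_lt hs), ContinuousLinearMap.adjoint_inner_right,
    ContinuousLinearMap.comp_apply]

/-- Among operators supported on finitely many nodes, the Gramian determines the weights. -/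
theorem linearIndependent_nodeGramian {S : C0Semigroup H} (hS : ExponentiallyStable S)
    (e : HilbertBasis ι ℝ H) : LinearIndependent ℝ (nodeGramian S e) := by
  classical
  rw [linearIndependent_iff']
  intro I c hc j hj
  -- At time `0` orthonormality leaves only `c j`, so it suffices to show `h 0 = 0`. Every tail
  -- integral of `h` vanishes, hence so does its primitive, whose right derivative at `0` is `h 0`.
  set h : ℝ → ℝ := fun s => ∑ i ∈ I, c i * ⟪S.toFun s (e i), e j⟫_ℝ ^ 2 with hh
  have hint : IntegrableOn h (Ioi 0) :=
    integrable_finsetSum _ fun i _ => (integrableOn_sq_inner_orbit hS (e i) (e j)).const_mul _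
  have hcont : ContinuousOn h (Ici 0) := by
    refine continuousOn_finsetSum _ fun i _ => continuousOn_const.mul (ContinuousOn.pow ?_ 2)
    exact (S.continuousOn_orbit (e i)).inner continuousOn_const
  have htail : ∀ t, 0 ≤ t → ∫ s in Ioi t, h s = 0 := by
    intro t ht
    set y := ContinuousLinearMap.adjoint (S.toFun t) (e j) with hy
    have h0 : ⟪y, (∑ i ∈ I, c i • nodeGramian S e i) y⟫_ℝ = 0 := by rw [hc]; simp
    simp only [sum_apply, inner_sum, smul_apply,
      inner_smul_right, hy, inner_nodeGramian_adjoint hS e _ _ ht] at h0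
    rw [integral_finsetSum]
    · simpa only [integral_const_mul] using h0
    · exact fun i _ => ((integrableOn_sq_inner_orbit hS (e i) (e j)).mono_set
        (Ioi_subset_Ioi ht)).const_mul _
  have hzero : ∀ t ∈ Ici (0 : ℝ), ∫ s in (0 : ℝ)..t, h s = 0 := by
    intro t ht
    rw [← intervalIntegral.integral_Ioi_sub_Ioi hint ht, htail 0 le_rfl, htail t ht, sub_zero]
  have hd : HasDerivWithinAt (fun t => ∫ s in (0 : ℝ)..t, h s) (h 0) (Ici 0) 0 :=
    intervalIntegral.integral_hasDerivWithinAt_right IntervalIntegrable.refl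
      (t := Ioi 0) ⟨Ioi 0, self_mem_nhdsWithin, hint.aestronglyMeasurable⟩
      (hcont.continuousWithinAt self_mem_Ici |>.mono Ioi_subset_Ici_self)
  have hd' : HasDerivWithinAt (fun t => ∫ s in (0 : ℝ)..t, h s) 0 (Ici 0) 0 :=
    (hasDerivWithinAt_const (0 : ℝ) (Ici (0 : ℝ)) (0 : ℝ)).congr hzero (hzero 0 self_mem_Ici)
  have hval : h 0 = 0 := (uniqueDiffWithinAt_Ici (0 : ℝ)).eq_deriv _ hd hd'
  have hj' : h 0 = c j := by
    simp only [hh, S.map_zero, ContinuousLinearMap.id_apply]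
    rw [Finset.sum_eq_single j]
    · simp [e.orthonormal.norm_eq_one]
    · intro i _ hij
      simp [e.orthonormal.inner_eq_zero hij]
    · exact fun hj' => absurd hj hj'
  rw [← hj', hval]

/-- The Gramian is additive in the weights. -/
theorem weightedGramian_eq_sum {S : C0Semigroup H} (hS : ExponentiallyStable S)
    (e : HilbertBasis ι ℝ H) {I : Finset ι} {p : ι → ℝ} (hp : p ∈ weightSimplex I) :
    weightedGramian S e p = ∑ i ∈ I, p i • nodeGramian S e i := by
  obtain ⟨hp0, hpI, -⟩ := hp
  have hB : inputOperator e p = ∑ i ∈ I, √(p i) • nodeProjection e i := by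
    refine tsum_eq_sum fun i hi => ?_
    rw [hpI i hi, Real.sqrt_zero, zero_smul]
  have hBB : (inputOperator e p).comp (ContinuousLinearMap.adjoint (inputOperator e p)) =
      ∑ i ∈ I, p i • nodeProjection e i := by
    ext x
    simp only [hB, map_sum, map_smulₛₗ, nodeProjection, adjoint_rankOne,
      ContinuousLinearMap.comp_apply, sum_apply,
      smul_apply, rankOne_apply, conj_trivial]
    refine Finset.sum_congr rfl fun i hi => ?_
    -- The cross terms of `B B*` vanish by orthogonality, and the square roots multiply to `p i`.
    rw [Finset.sum_eq_single i]
    · have h := Real.mul_self_sqrt (hp0 i)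
      simp only [smul_smul, real_inner_self_eq_norm_sq,
        e.orthonormal.norm_eq_one]
      congr 1
      linear_combination ⟪e i, x⟫_ℝ * h
    · intro j _ hji
      simp [e.orthonormal.inner_eq_zero hji]
    · exact fun h => absurd hi h
  have hI : ∀ i ∈ I, IntegrableOn
      (fun t => p i • rankOne ℝ (S.toFun t (e i)) (S.toFun t (e i))) (Ioi 0) :=
    fun i _ => (integrableOn_rankOne_orbit hS (e i)).smul (p i)
  simp only [nodeGramian_eq_integral, ← integral_smul]
  rw [← integral_finsetSum _ hI]
  unfold weightedGramian gramian
  congr 1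
  funext t
  rw [← ContinuousLinearMap.comp_assoc (inputOperator e p), hBB]
  ext x
  simp [nodeProjection, ContinuousLinearMap.adjoint_inner_right]

end Gramian

/-! ### Ordered eigenvalues of a finite-rank diagonal operator -/

section Spectrum

variable {H : Type*} [NormedAddCommGroup H] [InnerProductSpace ℝ H]

/-- An operator that is diagonal on a finite orthonormal family and vanishes on the orthogonal
complement is the corresponding diagonal sum. -/
theorem apply_eq_sum_of_orthonormal {n : ℕ} {T : H →L[ℝ] H} {z : Fin n → H} {a : Fin n → ℝ}
    (hz : Orthonormal ℝ z) (hT : ∀ k, T (z k) = a k • z k)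
    (h0 : ∀ x ∈ (Submodule.span ℝ (range z))ᗮ, T x = 0) (x : H) :
    T x = ∑ k, (⟪z k, x⟫_ℝ * a k) • z k := by
  have hmem : x - ∑ k, ⟪z k, x⟫_ℝ • z k ∈ (Submodule.span ℝ (range z))ᗮ := by
    rw [Submodule.mem_orthogonal]
    intro u hu
    induction hu using Submodule.span_induction with
    | mem u hu =>
      obtain ⟨k, rfl⟩ := hu
      rw [inner_sub_right, hz.inner_right_fintype, sub_self]
    | zero => exact inner_zero_left _
    | add u v _ _ hu hv => rw [inner_add_left, hu, hv, add_zero]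
    | smul c u _ hu => rw [inner_smul_left, hu, mul_zero]
  have h := h0 _ hmem
  rw [map_sub, sub_eq_zero] at h
  rw [h, map_sum]
  exact Finset.sum_congr rfl fun k _ => by rw [map_smul, hT, smul_smul]

/-- For an operator that is diagonal on a finite orthonormal family with nonincreasing nonnegative
eigenvalues and vanishes on the orthogonal complement, `eigenvalueDesc` lists these eigenvalues. -/
theorem eigenvalueDesc_eq_of_antitone {n : ℕ} {T : H →L[ℝ] H} {z : Fin n → H} {a : Fin n → ℝ}
    (hz : Orthonormal ℝ z) (hT : ∀ k, T (z k) = a k • z k)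
    (h0 : ∀ x ∈ (Submodule.span ℝ (range z))ᗮ, T x = 0)
    (ha : Antitone a) (ha0 : ∀ k, 0 ≤ a k) (k : Fin n) :
    eigenvalueDesc T (k + 1) = a k := by
  refine IsGreatest.csSup_eq ⟨?_, ?_⟩
  · have hk : (k : ℕ) + 1 ≤ n := k.2
    refine ⟨z ∘ Fin.castLE hk, hz.comp _ (Fin.castLE_injective hk), fun j => ⟨_, ?_, hT _⟩⟩
    exact ha (Fin.le_def.2 (Nat.lt_succ_iff.1 j.2))
  · rintro c ⟨v, hv, hvc⟩
    by_contra! hc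
    -- Dimension count: eigenvectors with eigenvalue above `a k` involve only the `z m` with `m <
    -- k`, so `k + 1` independent vectors would lie in the span of `k`.
    let w : Fin k → H := z ∘ Fin.castLE k.2.le
    have hmem : ∀ j, v j ∈ Submodule.span ℝ (range w) := by
      intro j
      obtain ⟨l, hcl, hl⟩ := hvc j
      have hl0 : a k < l := hc.trans_le hcl
      have hlpos : 0 < l := (ha0 k).trans_lt hl0
      have hsum := apply_eq_sum_of_orthonormal hz hT h0 (v j)
      rw [hl] at hsum
      have hcoef : ∀ m, k ≤ m → ⟪z m, v j⟫_ℝ = 0 := by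
        intro m hm
        have h1 : ⟪z m, l • v j⟫_ℝ = ⟪z m, v j⟫_ℝ * a m := by
          rw [hsum, hz.inner_right_fintype]
        rw [inner_smul_right] at h1
        have h2 : a m < l := (ha hm).trans_lt hl0
        have h3 : (l - a m) * ⟪z m, v j⟫_ℝ = 0 := by linear_combination h1
        exact (mul_eq_zero.1 h3).resolve_left (sub_pos.2 h2).ne'
      have hlv : l • v j ∈ Submodule.span ℝ (range w) := by
        rw [hsum]
        refine Submodule.sum_mem _ fun m _ => ?_
        by_cases hm : k ≤ m
        · rw [hcoef m hm, zero_mul, zero_smul]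
          exact Submodule.zero_mem _
        · exact Submodule.smul_mem _ _ (Submodule.subset_span ⟨⟨m, not_le.1 hm⟩, rfl⟩)
      -- Dividing by `l` is where nonnegativity of `a k` matters: it makes `l` positive, which rules
      -- out kernel vectors outside the span.
      exact (Submodule.smul_mem_iff _ hlpos.ne').1 hlv
    have : Fintype (range w) := Fintype.ofFinite _
    have hcard := linearIndependent_le_span' v hv.linearIndependent (range w)
      (range_subset_iff.2 hmem)
    have hw := Fintype.card_le_of_surjective _ (rangeFactorization_surjective (f := w))
    rw [Cardinal.mk_fin, Nat.cast_le] at hcard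
    rw [Fintype.card_fin] at hw
    omega

/-- The eigenvalues in descending order are a rearrangement of the diagonal entries. -/
theorem exists_perm_eigenvalueDesc_eq {n : ℕ} {T : H →L[ℝ] H} {z : Fin n → H} {a : Fin n → ℝ}
    (hz : Orthonormal ℝ z) (hT : ∀ k, T (z k) = a k • z k)
    (h0 : ∀ x ∈ (Submodule.span ℝ (range z))ᗮ, T x = 0) (ha0 : ∀ k, 0 ≤ a k) :
    ∃ σ : Equiv.Perm (Fin n), Antitone (a ∘ σ) ∧
      ∀ k : Fin n, eigenvalueDesc T (k + 1) = a (σ k) := by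
  -- `Tuple.sort` sorts upwards, so the negated entries are sorted.
  refine ⟨Tuple.sort fun k => -a k, ?_, fun k => ?_⟩
  · exact fun i j hij => neg_le_neg_iff.1 (Tuple.monotone_sort (fun k => -a k) hij)
  · set σ := Tuple.sort fun k => -a k
    refine eigenvalueDesc_eq_of_antitone (z := z ∘ σ) (a := a ∘ σ) (hz.comp _ σ.injective)
      (fun k => hT _) (fun x hx => h0 x ?_)
      (fun i j hij => neg_le_neg_iff.1 (Tuple.monotone_sort (fun k => -a k) hij))
      (fun k => ha0 _) k
    rwa [σ.surjective.range_comp] at hx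

variable {n : ℕ} {T : H →L[ℝ] H} {z : Fin n → H} {a : Fin n → ℝ}

theorem prod_eigenvalueDesc (hz : Orthonormal ℝ z) (hT : ∀ k, T (z k) = a k • z k)
    (h0 : ∀ x ∈ (Submodule.span ℝ (range z))ᗮ, T x = 0) (ha0 : ∀ k, 0 ≤ a k) :
    ∏ k ∈ Finset.Icc 1 n, eigenvalueDesc T k = ∏ k, a k := by
  obtain ⟨σ, -, hσ⟩ := exists_perm_eigenvalueDesc_eq hz hT h0 ha0
  rw [← Finset.Ico_add_one_right_eq_Icc, Finset.prod_Ico_eq_prod_range, Nat.add_sub_cancel,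
    Finset.prod_range, ← Equiv.prod_comp σ a]
  exact Finset.prod_congr rfl fun k _ => by rw [add_comm, hσ]

theorem sum_one_div_eigenvalueDesc (hz : Orthonormal ℝ z) (hT : ∀ k, T (z k) = a k • z k)
    (h0 : ∀ x ∈ (Submodule.span ℝ (range z))ᗮ, T x = 0) (ha0 : ∀ k, 0 ≤ a k) :
    ∑ k ∈ Finset.Icc 1 n, 1 / eigenvalueDesc T k = ∑ k, 1 / a k := by
  obtain ⟨σ, -, hσ⟩ := exists_perm_eigenvalueDesc_eq hz hT h0 ha0
  rw [← Finset.Ico_add_one_right_eq_Icc, Finset.sum_Ico_eq_sum_range, Nat.add_sub_cancel,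
    Finset.sum_range, ← Equiv.sum_comp σ fun k => 1 / a k]
  exact Finset.sum_congr rfl fun k _ => by rw [add_comm, hσ]

theorem eigenvalueDesc_pos_iff (hn : 0 < n) (hz : Orthonormal ℝ z)
    (hT : ∀ k, T (z k) = a k • z k)
    (h0 : ∀ x ∈ (Submodule.span ℝ (range z))ᗮ, T x = 0) (ha0 : ∀ k, 0 ≤ a k) :
    0 < eigenvalueDesc T n ↔ ∀ k, 0 < a k := by
  obtain ⟨σ, hanti, hσ⟩ := exists_perm_eigenvalueDesc_eq hz hT h0 ha0
  have hlast := hσ ⟨n - 1, Nat.sub_lt hn one_pos⟩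
  rw [show n - 1 + 1 = n from Nat.sub_add_cancel hn] at hlast
  rw [hlast]
  refine ⟨fun h k => ?_, fun h => h _⟩
  have hle : σ.symm k ≤ ⟨n - 1, Nat.sub_lt hn one_pos⟩ :=
    Fin.le_def.2 (Nat.le_sub_one_of_lt (σ.symm k).2)
  simpa using h.trans_le (hanti hle)

end Spectrum

/-! ### Compactness, strict convexity and existence of minimizers -/

section Optimization

variable {ι κ : Type*} [Fintype κ]

theorem isCompact_weightSimplex (I : Finset ι) : IsCompact (weightSimplex I) := by
  classical
  refine (isCompact_univ_pi fun _ : ι => isCompact_Icc (a := (0 : ℝ)) (b := 1)).of_isClosed_subset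
    ?_ ?_
  · have h1 : IsClosed {p : ι → ℝ | ∀ i, 0 ≤ p i} := by
      simp only [ofPred_forall]
      exact isClosed_iInter fun i => isClosed_le continuous_const (continuous_apply i)
    have h2 : IsClosed {p : ι → ℝ | ∀ i, i ∉ I → p i = 0} := by
      simp only [ofPred_forall]
      exact isClosed_iInter fun i => isClosed_iInter fun _ =>
        isClosed_eq (continuous_apply i) continuous_const
    have h3 : IsClosed {p : ι → ℝ | ∑ i ∈ I, p i = 1} :=
      isClosed_eq (continuous_finsetSum _ fun i _ => continuous_apply i) continuous_const
    exact h1.inter (h2.inter h3)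
  · rintro p ⟨hp0, hpI, hp1⟩ i -
    refine ⟨hp0 i, ?_⟩
    by_cases hi : i ∈ I
    · exact hp1 ▸ Finset.single_le_sum (fun j _ => hp0 j) hi
    · rw [hpI i hi]; exact zero_le_one

theorem convex_weightSimplex (I : Finset ι) : Convex ℝ (weightSimplex I) := by
  rintro p ⟨hp0, hpI, hp1⟩ q ⟨hq0, hqI, hq1⟩ s t hs ht hst
  refine ⟨fun i => ?_, fun i hi => ?_, ?_⟩
  · exact add_nonneg (mul_nonneg hs (hp0 i)) (mul_nonneg ht (hq0 i))
  · simp [hpI i hi, hqI i hi]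
  · simp only [Pi.add_apply, Pi.smul_apply, smul_eq_mul, Finset.sum_add_distrib,
      ← Finset.mul_sum, hp1, hq1, mul_one, hst]


/-- A sum of strictly convex functions of jointly injective linear coordinates is strictly
convex. -/
theorem strictConvexOn_sum_comp {E : Type*} [AddCommGroup E] [Module ℝ E] {φ : ℝ → ℝ}
    (hφ : StrictConvexOn ℝ (Ioi 0) φ) {D : Set E} (hD : Convex ℝ D) (L : E →ₗ[ℝ] κ → ℝ) (hL : InjOn L D) :
    StrictConvexOn ℝ {p ∈ D | ∀ k, 0 < L p k} fun p => ∑ k, φ (L p k) := by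
  refine ⟨fun p hp q hq s t hs ht hst => ⟨hD hp.1 hq.1 hs ht hst, fun k => ?_⟩,
    fun p hp q hq hpq s t hs ht hst => ?_⟩
  · rw [map_add, map_smul, map_smul]
    exact (convex_Ioi (0 : ℝ)) (hp.2 k) (hq.2 k) hs ht hst
  -- One coordinate that separates the points gives strict inequality; the others need only
  -- convexity.
  · obtain ⟨k, hk⟩ := Function.ne_iff.1 fun h => hpq (hL hp.1 hq.1 h)
    simp only [smul_eq_mul, Finset.mul_sum, ← Finset.sum_add_distrib, map_add, map_smul,
      Pi.add_apply, Pi.smul_apply]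
    exact Finset.sum_lt_sum
      (fun j _ => hφ.convexOn.2 (hp.2 j) (hq.2 j) hs.le ht.le hst)
      ⟨k, Finset.mem_univ _, hφ.2 (hp.2 k) (hq.2 k) hk hs ht hst⟩

variable {E : Type*} [TopologicalSpace E]

/-- A positive product of continuous nonnegative functions attains its maximum on a compact set
at a point where all factors are positive, so `-log` of it attains its minimum. -/
theorem exists_forall_neg_sum_log_le {D : Set E} (hD : IsCompact D) {L : E → κ → ℝ}
    (hL : ContinuousOn L D) (hL0 : ∀ p ∈ D, ∀ k, 0 ≤ L p k)
    (hne : {p ∈ D | ∀ k, 0 < L p k}.Nonempty) :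
    ∃ p ∈ {p ∈ D | ∀ k, 0 < L p k}, ∀ q ∈ {p ∈ D | ∀ k, 0 < L p k},
      ∑ k, -Real.log (L p k) ≤ ∑ k, -Real.log (L q k) := by
  obtain ⟨p₀, hp₀, hpos₀⟩ := hne
  have hc : ContinuousOn (fun p => ∏ k, L p k) D :=
    continuousOn_finsetProd _ fun k _ => continuousOn_pi.1 hL k
  obtain ⟨p, hp, hmax⟩ := hD.exists_isMaxOn ⟨p₀, hp₀⟩ hc
  have hppos : 0 < ∏ k, L p k :=
    (Finset.prod_pos fun k _ => hpos₀ k).trans_le (hmax hp₀)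
  have hpk : ∀ k, 0 < L p k := fun k => (hL0 p hp k).lt_of_ne'
    (Finset.prod_ne_zero_iff.1 hppos.ne' k (Finset.mem_univ k))
  refine ⟨p, ⟨hp, hpk⟩, fun q hq => ?_⟩
  rw [Finset.sum_neg_distrib, Finset.sum_neg_distrib, neg_le_neg_iff,
    ← Real.log_prod fun k _ => (hpk k).ne', ← Real.log_prod fun k _ => (hq.2 k).ne']
  exact Real.log_le_log (Finset.prod_pos fun k _ => hq.2 k) (hmax hq.1)

/-- A point doing at least as well as a reference value `g` has each `1 / L p k ≤ g`, so the search
can be confined to the compact set `L p k ≥ 1 / g`, where the objective is continuous. -/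
theorem exists_forall_sum_one_div_le [Nonempty κ] {D : Set E} (hD : IsCompact D) {L : E → κ → ℝ}
    (hL : Continuous L) (hne : {p ∈ D | ∀ k, 0 < L p k}.Nonempty) :
    ∃ p ∈ {p ∈ D | ∀ k, 0 < L p k}, ∀ q ∈ {p ∈ D | ∀ k, 0 < L p k},
      ∑ k, 1 / L p k ≤ ∑ k, 1 / L q k := by
  obtain ⟨p₀, hp₀, hpos₀⟩ := hne
  have hterm : ∀ q, (∀ k, 0 < L q k) → ∀ k, 1 / L q k ≤ ∑ k, 1 / L q k := fun q hq k =>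
    Finset.single_le_sum (f := fun k => 1 / L q k) (fun j _ => (one_div_pos.2 (hq j)).le)
      (Finset.mem_univ k)
  set g := ∑ k, 1 / L p₀ k with hg
  have hg0 : 0 < g := Finset.sum_pos (fun k _ => one_div_pos.2 (hpos₀ k)) Finset.univ_nonempty
  have hK : IsCompact {p ∈ D | ∀ k, 1 / g ≤ L p k} := by
    have hcl : IsClosed {p : E | ∀ k, 1 / g ≤ L p k} := by
      simp only [ofPred_forall]
      exact isClosed_iInter fun k =>
        isClosed_le continuous_const ((continuous_apply k).comp hL)
    exact hD.inter_right hcl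
  have hKpos : ∀ p ∈ {p ∈ D | ∀ k, 1 / g ≤ L p k}, ∀ k, 0 < L p k := fun p hp k =>
    (one_div_pos.2 hg0).trans_le (hp.2 k)
  have hsub : ∀ q, q ∈ D → (∀ k, 0 < L q k) → ∑ k, 1 / L q k ≤ g →
      q ∈ {p ∈ D | ∀ k, 1 / g ≤ L p k} := fun q hq hq0 hle =>
    ⟨hq, fun k => (one_div_le hg0 (hq0 k)).2 ((hterm q hq0 k).trans hle)⟩
  have hp₀K := hsub p₀ hp₀ hpos₀ le_rfl
  have hc : ContinuousOn (fun p => ∑ k, 1 / L p k) {p ∈ D | ∀ k, 1 / g ≤ L p k} :=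
    continuousOn_finsetSum _ fun k _ => continuousOn_const.div
      ((continuous_apply k).comp hL).continuousOn fun p hp => (hKpos p hp k).ne'
  obtain ⟨p, hp, hmin⟩ := hK.exists_isMinOn ⟨p₀, hp₀K⟩ hc
  refine ⟨p, ⟨hp.1, hKpos p hp⟩, fun q hq => ?_⟩
  rcases le_total (∑ k, 1 / L q k) g with h | h
  · exact hmin (hsub q hq.1 hq.2 h)
  · exact (hmin hp₀K).trans h

/-- A strictly convex minimization problem with an optimal solution has exactly one. -/
theorem existsUnique_isOptimalSolution {F : Set (ι → ℝ)} {f h : (ι → ℝ) → ℝ}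
    (hf : StrictConvexOn ℝ F f) (hfh : EqOn h f F) (hex : ∃ p ∈ F, ∀ q ∈ F, f p ≤ f q) :
    ∃! p, IsOptimalSolution h F p := by
  obtain ⟨p, hp, hmin⟩ := hex
  refine ⟨p, ⟨hp, fun q hq => ?_⟩, fun q hq => ?_⟩
  · rw [hfh hp, hfh hq]; exact hmin q hq
  · refine hf.eq_of_isMinOn (fun r hr => ?_) (fun r hr => hmin r hr) hq.1 hp
    have := hq.2 r hr
    rwa [hfh hq.1, hfh hr] at this

end Optimization

/-! ### Eigenvalues as linear coordinates, and the main theorem -/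

/-- The eigenvalues of the weighted Gramian on the common eigenvectors, as a linear function of
the weights; `a i k` is the eigenvalue of the Gramian of node `i` on the `k`-th eigenvector. -/
noncomputable def eigenvalueMap {ι κ : Type*} (I : Finset ι) (a : ι → κ → ℝ) : (ι → ℝ) →ₗ[ℝ] κ → ℝ :=
  ∑ i ∈ I, (LinearMap.proj i).smulRight (a i)

theorem eigenvalueMap_apply {ι κ : Type*} (I : Finset ι) (a : ι → κ → ℝ) (p : ι → ℝ) (k : κ) :
    eigenvalueMap I a p k = ∑ i ∈ I, p i * a i k := by
  simp [eigenvalueMap]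

theorem continuous_eigenvalueMap {ι κ : Type*} (I : Finset ι) (a : ι → κ → ℝ) :
    Continuous (eigenvalueMap I a) := by
  refine continuous_pi fun k => ?_
  simp only [eigenvalueMap_apply]
  fun_prop

end ControllabilityScore

theorem mainTheorem2 {H : Type*} [NormedAddCommGroup H] [InnerProductSpace ℝ H]
    [CompleteSpace H] {ι : Type*} [Countable ι] (e : HilbertBasis ι ℝ H)
    (A : H →ₗ.[ℝ] H) (S : ControllabilityScore.C0Semigroup H)
    (hA : ControllabilityScore.IsGenerator A S)
    (hS : ControllabilityScore.ExponentiallyStable S)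
    (n : ℕ) (hn : 0 < n) (I : Finset ι)
    (hfeas : (ControllabilityScore.feasibleSet S e I n).Nonempty)
    (hcomm : ∀ i j : ι,
      (ControllabilityScore.nodeGramian S e i).comp (ControllabilityScore.nodeGramian S e j) =
        (ControllabilityScore.nodeGramian S e j).comp (ControllabilityScore.nodeGramian S e i))
    (hspec : ∃ z : Fin n → H, Orthonormal ℝ z ∧
      (∀ (i : ι) (k : Fin n), ∃ l : ℝ, ControllabilityScore.nodeGramian S e i (z k) = l • z k) ∧
      ∀ i ∈ I, ∀ x ∈ (Submodule.span ℝ (Set.range z))ᗮ,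
        ControllabilityScore.nodeGramian S e i x = 0) :
    (∃! p : ι → ℝ, ControllabilityScore.IsOptimalSolution
      (ControllabilityScore.vcsObjective S e n)
      (ControllabilityScore.feasibleSet S e I n) p) ∧
    (∃! p : ι → ℝ, ControllabilityScore.IsOptimalSolution
      (ControllabilityScore.aecsObjective S e n)
      (ControllabilityScore.feasibleSet S e I n) p) := by
  open ControllabilityScore in
  obtain ⟨z, hz, hdiag, hker⟩ := hspec
  choose a ha using hdiag
  have ha0 : ∀ i k, 0 ≤ a i k := fun i k => by
    have h := inner_nodeGramian_nonneg hS e i (z k)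
    rwa [ha, inner_smul_right, real_inner_self_eq_norm_sq, hz.norm_eq_one, one_pow, mul_one] at h
  set L := eigenvalueMap I a
  have hdiagW : ∀ p ∈ weightSimplex I, ∀ k, weightedGramian S e p (z k) = L p k • z k :=
    fun p hp k => by
      simp [weightedGramian_eq_sum hS e hp, L, eigenvalueMap_apply, ha, smul_smul,
        Finset.sum_smul]
  have hkerW : ∀ p ∈ weightSimplex I, ∀ x ∈ (Submodule.span ℝ (Set.range z))ᗮ,
      weightedGramian S e p x = 0 := fun p hp x hx => by
    rw [weightedGramian_eq_sum hS e hp, sum_apply]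
    exact Finset.sum_eq_zero fun i hi => by rw [smul_apply, hker i hi x hx, smul_zero]
  have hL0 : ∀ p ∈ weightSimplex I, ∀ k, 0 ≤ L p k := fun p hp k => by
    rw [eigenvalueMap_apply]
    exact Finset.sum_nonneg fun i _ => mul_nonneg (hp.1 i) (ha0 i k)
  have hLc : Continuous L := continuous_eigenvalueMap I a
  have hF : feasibleSet S e I n = {p ∈ weightSimplex I | ∀ k, 0 < L p k} := by
    ext p
    exact and_congr_right fun hp =>
      eigenvalueDesc_pos_iff hn hz (hdiagW p hp) (hkerW p hp) (hL0 p hp)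
  -- Equal eigenvalues on the same eigenvectors give equal Gramians; linear independence then
  -- recovers the weights on `I`, and off `I` they are zero.
  have hinj : Set.InjOn L (weightSimplex I) := by
    intro p hp q hq hpq
    have hW : weightedGramian S e p = weightedGramian S e q := by
      ext x
      rw [apply_eq_sum_of_orthonormal hz (hdiagW p hp) (hkerW p hp),
        apply_eq_sum_of_orthonormal hz (hdiagW q hq) (hkerW q hq), hpq]
    rw [weightedGramian_eq_sum hS e hp, weightedGramian_eq_sum hS e hq] at hW
    have hli := linearIndependent_iff'.1 (linearIndependent_nodeGramian hS e) I (p - q) (by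
      simp only [Pi.sub_apply, sub_smul, Finset.sum_sub_distrib, hW, sub_self])
    funext i
    by_cases hi : i ∈ I
    · exact sub_eq_zero.1 (hli i hi)
    · rw [hp.2.1 i hi, hq.2.1 i hi]
  rw [hF] at hfeas ⊢
  have : Nonempty (Fin n) := ⟨⟨0, hn⟩⟩
  constructor
  · refine existsUnique_isOptimalSolution
      (strictConvexOn_sum_comp strictConcaveOn_log_Ioi.neg (convex_weightSimplex I) L hinj)
      (fun p hp => ?_)
      (exists_forall_neg_sum_log_le (isCompact_weightSimplex I) hLc.continuousOn hL0 hfeas)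
    simp only [vcsObjective, Pi.neg_apply]
    rw [prod_eigenvalueDesc hz (hdiagW p hp.1) (hkerW p hp.1) (hL0 p hp.1),
      Real.log_prod fun k _ => (hp.2 k).ne', Finset.sum_neg_distrib]
  · have hinv : StrictConvexOn ℝ (Set.Ioi 0) fun x : ℝ => 1 / x := by
      simpa using strictConvexOn_zpow (m := -1) (by norm_num) (by norm_num)
    exact existsUnique_isOptimalSolution
      (strictConvexOn_sum_comp hinv (convex_weightSimplex I) L hinj)
      (fun p hp => sum_one_div_eigenvalueDesc hz (hdiagW p hp.1) (hkerW p hp.1) (hL0 p hp.1))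
      (exists_forall_sum_one_div_le (isCompact_weightSimplex I) hLc hfeas)
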